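/- Let $k\ge 0$ be an integer, let $\Lambda_k=\{0,1,\dots,k\}\subset\mathbb{Z}$ and $X_k=\{0,1\}^{\Lambda_k}$. A probability measure $\mu$ on $X_k$ is called locally translation invariant (LTI) if, for every $A\subseteq\Lambda_k$ and $t\in\mathbb{Z}$ with $A+t\subseteq\Lambda_k$, the marginal of $\mu$ on $\{0,1\}^{A+t}$ is the translate by $t$ of the marginal of $\mu$ on $\{0,1\}^{A}$. For an integer $L\ge 1$ let $\mathbb{Z}_L=\{0,\dots,L-1\}$ be the ring with $L$ sites (translation modulo $L$) and $Y_L=\{0,1\}^{\mathbb{Z}_L}$. For $L\ge k+1$, a translation-invariant probability measure $\nu$ on $Y_L$ extends $\mu$ if the marginal of $\nu$ on the sites $0,1,\dots,k$ is $\mu$. Theorem. The smallest integer $L\ge k+1$ such that every LTI probability measure on $X_k$ extends to a translation-invariant probability measure on $Y_L$ is $$L_0(k)=\operatorname{lcm}\{1,2,3,\dots,2^k-1,2^k\}.$$ -/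

import Mathlib

open MeasureTheory

/-- Particle configurations `{0,1}^Λ` on a set of sites `Λ`. -/
abbrev Config (Λ : Type*) : Type _ := Λ → Fin 2

/-- The marginal on `X_A` of a measure on `X_Λ`, for `A ⊆ Λ ⊆ ℤ`. -/
noncomputable def marginal {Λ A : Set ℤ} (h : A ⊆ Λ) (μ : Measure (Config Λ)) :
    Measure (Config A) :=
  μ.map (Set.domRestrict₂ (π := fun _ : ℤ => Fin 2) h)

/-- The translate by `t` of a configuration on `A`: a configuration on `A + t`. -/
def translateConfig (A : Set ℤ) (t : ℤ) (η : Config A) :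
    Config ((fun i : ℤ => i + t) '' A) :=
  fun i => η ⟨(i : ℤ) - t, by
    obtain ⟨_, j, hj, rfl⟩ := i
    simpa using hj⟩

theorem measurable_translateConfig (A : Set ℤ) (t : ℤ) : Measurable (translateConfig A t) :=
  measurable_pi_lambda _ fun _ => measurable_pi_apply _

/-- Local translation invariance: whenever `A` and its translate `A + t` both lie in `Λ`, the
marginal on `X_{A + t}` is the translate of the marginal on `X_A`. -/
def IsLTI {Λ : Set ℤ} (μ : Measure (Config Λ)) : Prop :=
  ∀ (A : Set ℤ) (t : ℤ) (hA : A ⊆ Λ) (hA' : (fun i : ℤ => i + t) '' A ⊆ Λ),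
    marginal hA' μ = (marginal hA μ).map (translateConfig A t)

/-- The interval `Λ_k = {0, 1, …, k}` of `ℤ`. -/
abbrev interval (k : ℕ) : Set ℤ := Set.Icc 0 (k : ℤ)

/-- Translation invariance of a measure on configurations on the ring `ℤ_L`. -/
def IsTIRing {L : ℕ} (ν : Measure (Config (ZMod L))) : Prop :=
  ∀ t : ZMod L, ν.map (fun (η : Config (ZMod L)) (i : ZMod L) => η (i + t)) = ν

/-- `ν`, a measure on configurations on the ring `ℤ_L`, extends `μ`: its marginal on the sites
`0, 1, …, k` of the ring (distinct sites when `k + 1 ≤ L`) is `μ`. -/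
def ExtendsOnRing {k L : ℕ} (ν : Measure (Config (ZMod L)))
    (μ : Measure (Config (interval k))) : Prop :=
  ν.map (fun (η : Config (ZMod L)) (i : interval k) => η ((i : ℤ) : ZMod L)) = μ

/-! An LTI measure is a circulation on the binary de Bruijn graph: vertices are words of length k,
edges are words of length k + 1, and LTI makes inflow equal outflow at each vertex
(`IsLTI.measure_subwindow`). By `circulation_induction` it is a nonnegative combination of simple
cycles, whose lengths n are at most 2 ^ k. If n ∣ L, the cycle wraps around the ring L / n times,
and a uniform rotation makes it translation invariant.

Conversely, a simple cycle of every length n ≤ 2 ^ k exists (`exists_cyclic_sequence`). Its window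
measure is LTI, and any configuration typical for an extension must follow the cycle step by step,
hence closes up after L sites only if n ∣ L (`dvd_of_extendsOnRing`). -/

theorem ZMod.val_add_one_eq_mod {n : ℕ} [NeZero n] (i : ZMod n) :
    (i + 1).val = (i.val + 1) % n := by
  conv_lhs => rw [← ZMod.natCast_zmod_val i, ← Nat.cast_succ, ZMod.val_natCast]

/-! ### Decomposition of circulations into simple cycles -/

open scoped NNReal ENNReal in
/-- Every nonnegative circulation on a finite directed multigraph lies in any convex cone that
contains the indicators of all simple cycles. -/
theorem circulation_induction {V E : Type*} [Fintype V] [DecidableEq V] [Fintype E] [DecidableEq E]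
    (src tgt : E → V) (P : (E → ℝ≥0) → Prop) (zero : P 0)
    (add : ∀ m m', P m → P m' → P (m + m')) (smul : ∀ (a : ℝ≥0) m, P m → P (a • m))
    (cycle : ∀ (n : ℕ) [NeZero n] (e : ZMod n → E), n ≤ Fintype.card V →
      (∀ i, tgt (e i) = src (e (i + 1))) → e.Injective →
      P (fun x => if x ∈ Set.range e then 1 else 0))
    (m : E → ℝ≥0) (hm : ∀ v, ∑ x with src x = v, m x = ∑ x with tgt x = v, m x) : P m := by
  classical
  -- Induction on the size of the support: subtracting the least weight along a cycle removes an
  -- edge from it.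
  induction hN : (Finset.univ.filter fun x => m x ≠ 0).card using Nat.strong_induction_on
    generalizing m with
  | _ N ih =>
  by_cases h0 : m = 0
  · exact h0 ▸ zero
  have hsucc : ∀ x, m x ≠ 0 → ∃ y, m y ≠ 0 ∧ src y = tgt x := by
    intro x hx
    by_contra! hy
    have h1 : ∑ y with src y = tgt x, m y = 0 := by
      refine Finset.sum_eq_zero fun y hy' => ?_
      by_contra h
      exact hy y h (by simpa using hy')
    rw [hm, Finset.sum_eq_zero_iff] at h1
    exact hx (h1 x (by simp))
  let S : Set V := {v | ∃ x, m x ≠ 0 ∧ src x = v}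
  -- Following one chosen support edge out of each vertex is a self-map of a finite set; a minimal
  -- period of it is a simple cycle.
  choose out hout hsrc using fun v : S => v.2
  let g : S → S := fun v => ⟨tgt (out v), hsucc _ (hout v)⟩
  obtain ⟨x₀, hx₀⟩ : ∃ x, m x ≠ 0 := by
    by_contra! h
    exact h0 (funext h)
  obtain ⟨v, hv⟩ : ∃ v, v ∈ Function.periodicPts g := by
    obtain ⟨a, b, hab, h⟩ := Finite.exists_ne_map_eq_of_infinite
      (fun n : ℕ => g^[n] ⟨src x₀, x₀, hx₀, rfl⟩)
    wlog hlt : a < b generalizing a b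
    · exact this b a hab.symm h.symm (by omega)
    refine ⟨g^[a] ⟨src x₀, x₀, hx₀, rfl⟩, Function.mk_mem_periodicPts (n := b - a) (by omega) ?_⟩
    rw [Function.IsPeriodicPt, Function.IsFixedPt, ← Function.iterate_add_apply,
      Nat.sub_add_cancel hlt.le]
    exact h.symm
  set n := Function.minimalPeriod g v with hn
  have hpos : 0 < n := Function.minimalPeriod_pos_of_mem_periodicPts hv
  have : NeZero n := ⟨hpos.ne'⟩
  have hout_inj : out.Injective := fun a b h => Subtype.ext (by rw [← hsrc a, ← hsrc b, h])
  let e : ZMod n → E := fun i => out (g^[i.val] v)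
  have hv_inj : Function.Injective (fun i : ZMod n => g^[i.val] v) := fun i j h =>
    ZMod.val_injective n (Function.iterate_injOn_Iio_minimalPeriod (ZMod.val_lt i) (ZMod.val_lt j) h)
  have he : e.Injective := hout_inj.comp hv_inj
  have hstep : ∀ i, tgt (e i) = src (e (i + 1)) := by
    intro i
    rw [hsrc]
    have : g^[(i + 1).val] v = g^[i.val + 1] v := by
      rw [ZMod.val_add_one_eq_mod]
      exact Function.iterate_mod_minimalPeriod_eq
    rw [this, Function.iterate_succ_apply']
  have hcard : n ≤ Fintype.card V := by
    simpa [ZMod.card] using Fintype.card_le_of_injective _ (Subtype.val_injective.comp hv_inj)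
  obtain ⟨i₀, hi₀⟩ := Finite.exists_min (fun i => m (e i))
  let c : E → ℝ≥0 := fun x => if x ∈ Set.range e then 1 else 0
  let a := m (e i₀)
  have hle : ∀ x, a * c x ≤ m x := by
    intro x
    by_cases hx : x ∈ Set.range e
    · obtain ⟨i, rfl⟩ := hx
      simpa [c] using hi₀ i
    · simp only [c, if_neg hx, mul_zero, zero_le]
  let m' : E → ℝ≥0 := fun x => m x - a * c x
  have hm' : m = m' + a • c := by
    funext x
    simp [m', tsub_add_cancel_of_le (hle x)]
  have hsumc : ∀ (f : E → V) (w : V),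
      ∑ x with f x = w, c x = ∑ i : ZMod n, if f (e i) = w then 1 else 0 := by
    intro f w
    have h1 : ∀ x, c x = ∑ i : ZMod n, if e i = x then 1 else 0 := by
      intro x
      by_cases hx : x ∈ Set.range e
      · obtain ⟨i, rfl⟩ := hx
        simp [c, he.eq_iff]
      · have : ∀ i, e i ≠ x := fun i h => hx ⟨i, h⟩
        simp [c, this]
    simp only [h1]
    rw [Finset.sum_comm]
    refine Finset.sum_congr rfl fun i _ => ?_
    rw [Finset.sum_ite_eq]
    simp
  have hc : ∀ w, ∑ x with src x = w, c x = ∑ x with tgt x = w, c x := by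
    intro w
    rw [hsumc, hsumc, ← Equiv.sum_comp (Equiv.addRight (1 : ZMod n))]
    simp only [Equiv.coe_addRight, hstep]
    congr!
  have hbal : ∀ w, ∑ x with src x = w, m' x = ∑ x with tgt x = w, m' x := by
    intro w
    have h := hm w
    rw [hm'] at h
    simp only [Pi.add_apply, Pi.smul_apply, smul_eq_mul, Finset.sum_add_distrib,
      ← Finset.mul_sum, hc w] at h
    exact add_right_cancel h
  rw [hm']
  refine add _ _ (ih _ ?_ m' hbal rfl) (smul _ _ (cycle n e hcard hstep he))
  rw [← hN]
  refine Finset.card_lt_card ⟨fun x hx => ?_, fun hsub => ?_⟩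
  · simp only [Finset.mem_filter, Finset.mem_univ, true_and, m'] at hx ⊢
    intro h
    simp [h] at hx
  · have := hsub (show e i₀ ∈ _ by simpa using hout _)
    simp [m', c, a] at this

/-! ### Pancyclicity of the de Bruijn graph -/

/-- In a finite field of order `2 ^ k` there are an element `α` of multiplicative order `2 ^ k - 1`
and a linear functional `φ` such that `x ↦ (φ (α ^ s * x))_{s < k}` is bijective. -/
theorem exists_linear_recurrence {F : Type*} [Field F] [Fintype F] [Algebra (ZMod 2) F] (k : ℕ)
    (hrank : Module.finrank (ZMod 2) F = k) :
    ∃ (u : Fˣ) (φ : F →ₗ[ZMod 2] ZMod 2), orderOf u = 2 ^ k - 1 ∧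
      (∀ x : F, (∀ s < k, φ ((u : F) ^ s * x) = 0) → x = 0) ∧
      Function.Surjective fun (x : F) (s : Fin k) => φ ((u : F) ^ (s : ℕ) * x) := by
  classical
  have : Fact (Nat.Prime 2) := ⟨Nat.prime_two⟩
  have hcard : Fintype.card F = 2 ^ k := by
    rw [Module.card_eq_pow_finrank (K := ZMod 2), hrank, ZMod.card]
  obtain ⟨u, hu⟩ := IsCyclic.exists_generator (α := Fˣ)
  have hord : orderOf u = 2 ^ k - 1 := by
    rw [orderOf_eq_card_of_forall_mem_zpowers hu, Nat.card_eq_fintype_card, Fintype.card_units, hcard]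
  let α : F := u
  obtain ⟨φ, hφ⟩ : ∃ φ : Module.Dual (ZMod 2) F, φ 1 ≠ 0 := by
    by_contra! h
    exact one_ne_zero ((Module.forall_dual_apply_eq_zero_iff (ZMod 2) (1 : F)).1 h)
  have hadj : Algebra.adjoin (ZMod 2) {α} = ⊤ := by
    refine eq_top_iff.2 fun x _ => ?_
    by_cases hx : x = 0
    · rw [hx]; exact zero_mem _
    · obtain ⟨r, hr⟩ := mem_powers_iff_mem_zpowers.2 (hu (Units.mk0 x hx))
      have : α ^ r = x := by simpa [α] using congrArg Units.val hr
      rw [← this]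
      exact pow_mem (Algebra.subset_adjoin (Set.mem_singleton α)) r
  have hint : IsIntegral (ZMod 2) α := Algebra.IsIntegral.isIntegral α
  obtain ⟨pb, hpb⟩ : ∃ pb : PowerBasis (ZMod 2) F, pb.gen = α :=
    ⟨PowerBasis.ofAdjoinEqTop hint hadj, PowerBasis.ofAdjoinEqTop_gen hint hadj⟩
  have hdim : pb.dim = k := by rw [← pb.finrank, hrank]
  -- The powers α ^ s with s < k form a basis, so z ↦ φ (z * x) vanishes; at z = x⁻¹ this
  -- contradicts φ 1 ≠ 0.
  have hwin : ∀ x : F, (∀ s < k, φ (α ^ s * x) = 0) → x = 0 := by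
    intro x hx
    by_contra hx0
    have : φ ∘ₗ LinearMap.mulRight (ZMod 2) x = 0 := by
      refine pb.basis.ext fun i => ?_
      simpa [hpb] using hx i (hdim ▸ i.2)
    have h1 := LinearMap.congr_fun this x⁻¹
    simp [hx0] at h1
    exact hφ h1
  let w : F →ₗ[ZMod 2] (Fin k → ZMod 2) := LinearMap.pi fun s => φ ∘ₗ LinearMap.mulLeft (ZMod 2) (α ^ (s : ℕ))
  have hwinj : Function.Injective w := by
    refine (injective_iff_map_eq_zero w).2 fun x hx => hwin x fun s hs => ?_
    simpa [w] using congrFun hx ⟨s, hs⟩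
  have hwsurj : Function.Surjective w :=
    (LinearMap.injective_iff_surjective_of_finrank_eq_finrank (by simp [hrank])).1 hwinj
  exact ⟨u, φ, hord, hwin, hwsurj⟩

/-- For `1 ≤ n ≤ 2 ^ k` there is a cyclic binary sequence of length `n` whose windows of length `k`
are pairwise distinct: the binary de Bruijn graph of order `k` is pancyclic. -/
theorem exists_cyclic_sequence (k n : ℕ) [NeZero n] (hn : n ≤ 2 ^ k) :
    ∃ c : ZMod n → Fin 2, ∀ i j : ZMod n, (∀ s < k, c (i + s) = c (j + s)) → i = j := by
  have hn0 : 0 < n := Nat.pos_of_ne_zero (NeZero.ne n)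
  rcases Nat.eq_zero_or_pos k with rfl | hk
  · obtain rfl : n = 1 := by simp at hn; omega
    exact ⟨fun _ => 0, fun i j _ => Subsingleton.elim i j⟩
  have : Fact (Nat.Prime 2) := ⟨Nat.prime_two⟩
  obtain ⟨F, _, _, _, hrank⟩ : ∃ (F : Type) (_ : Field F) (_ : Fintype F) (_ : Algebra (ZMod 2) F),
      Module.finrank (ZMod 2) F = k :=
    ⟨GaloisField 2 k, inferInstance, Fintype.ofFinite _, inferInstance,
      GaloisField.finrank 2 hk.ne'⟩
  obtain ⟨u, φ, hord, hwin, hwsurj⟩ := exists_linear_recurrence (F := F) k hrank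
  let α : F := u
  have hα : α ≠ 0 := u.ne_zero
  -- Adding e changes only the last letter of a window, so y → α y + b e are exactly the de Bruijn
  -- edges.
  obtain ⟨e, he⟩ := hwsurj (Pi.single ⟨k - 1, by omega⟩ 1)
  have he0 : e ≠ 0 := by
    rintro rfl
    simpa using congrFun he ⟨k - 1, by omega⟩
  have hes : ∀ s, s + 1 < k → φ (α ^ s * e) = 0 := by
    intro s hs
    have := congrFun he ⟨s, by omega⟩
    rw [Pi.single_eq_of_ne (by simp [Fin.ext_iff]; omega)] at this
    simpa using this
  have hpow : ∀ {a b : ℕ} {x : F}, a < 2 ^ k - 1 → b < 2 ^ k - 1 → x ≠ 0 →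
      α ^ a * x = α ^ b * x → a = b := by
    intro a b x ha hb hx h
    have h1 : u ^ a = u ^ b := Units.ext (by simpa [α] using mul_right_cancel₀ hx h)
    exact pow_injOn_Iio_orderOf (by simpa [hord] using ha) (by simpa [hord] using hb) h1
  have hfull : α ^ (2 ^ k - 1) = 1 := by
    have := pow_orderOf_eq_one u
    rw [hord] at this
    simpa [α] using congrArg Units.val this
  have hk2 : 2 ≤ 2 ^ k := by simpa using Nat.pow_le_pow_right (n := 2) (by norm_num) hk
  -- a simple cycle of length `n` in the graph with edges `y → α y` and `y → α y + e`
  obtain ⟨x, hxinj, hxstep, hxlast⟩ : ∃ x : ℕ → F, Set.InjOn x (Set.Iio n) ∧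
      (∀ i, i + 1 < n → ∃ b : ZMod 2, x (i + 1) = α * x i + b • e) ∧
      ∃ b : ZMod 2, x 0 = α * x (n - 1) + b • e := by
    rcases lt_trichotomy n (2 ^ k - 1) with h | h | h
    -- The start x solves x = α ^ n x + e, so a single correction by e closes the cycle.
    · have h1 : α ^ n ≠ 1 := by
        intro h2
        have := hpow (a := n) (b := 0) h (by omega) one_ne_zero (by simpa using h2)
        omega
      have h2 : 1 - α ^ n ≠ 0 := sub_ne_zero.2 h1.symm
      refine ⟨fun i => α ^ i * (e / (1 - α ^ n)), fun i hi j hj hij => ?_, fun i hi => ⟨0, ?_⟩, 1, ?_⟩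
      · simp only [Set.mem_Iio] at hi hj
        exact hpow (by omega) (by omega) (div_ne_zero he0 h2) hij
      · simp [pow_succ']; ring
      · obtain ⟨m, rfl⟩ : ∃ m, n = m + 1 := ⟨n - 1, by omega⟩
        simp only [Nat.add_sub_cancel, one_smul, pow_zero]
        field_simp
        ring
    · refine ⟨fun i => α ^ i, fun i hi j hj hij => ?_, fun i hi => ⟨0, ?_⟩, 0, ?_⟩
      · simp only [Set.mem_Iio] at hi hj
        exact hpow (by omega) (by omega) one_ne_zero (by simpa using hij)
      · simp [pow_succ']
      · obtain ⟨m, rfl⟩ : ∃ m, n = m + 1 := ⟨n - 1, by omega⟩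
        simp only [Nat.add_sub_cancel, zero_smul, pow_zero, add_zero]
        rw [← pow_succ', h, hfull]
    -- Insert 0 into the orbit of e, just before it returns to e.
    · obtain rfl : n = 2 ^ k := by omega
      refine ⟨fun i => if i < 2 ^ k - 1 then α ^ i * e else 0, fun i hi j hj hij => ?_, fun i hi => ?_,
        1, ?_⟩
      · simp only [Set.mem_Iio] at hi hj
        dsimp only at hij
        split_ifs at hij with h1 h2 h2
        · exact hpow h1 h2 he0 hij
        · simp [hα, he0] at hij
        · simp [hα, he0] at hij
        · omega
      · by_cases h1 : i + 1 < 2 ^ k - 1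
        · refine ⟨0, ?_⟩
          simp only [h1, (show i < 2 ^ k - 1 by omega), if_true]
          simp [pow_succ', mul_assoc]
        · refine ⟨-1, ?_⟩
          have h2 : i + 1 = 2 ^ k - 1 := by omega
          simp only [h1, (show i < 2 ^ k - 1 by omega), if_true, if_false]
          rw [← mul_assoc, ← pow_succ', h2, hfull, neg_smul, one_smul, one_mul, add_neg_cancel]
      · simp [show 0 < 2 ^ k - 1 by omega]
  let y : ZMod n → F := fun i => x i.val
  have hystep : ∀ i, ∃ b : ZMod 2, y (i + 1) = α * y i + b • e := by
    intro i
    have hv := ZMod.val_add_one_eq_mod i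
    have hi := ZMod.val_lt i
    by_cases h : i.val + 1 < n
    · simpa only [y, hv, Nat.mod_eq_of_lt h] using hxstep _ h
    · have h1 : i.val = n - 1 := by omega
      have h2 : i.val + 1 = n := by omega
      simp only [y, hv, h2, Nat.mod_self]
      rw [h1]
      exact hxlast
  -- The corrections by e are invisible to these functionals; r is there for the induction.
  have hyw : ∀ (s : ℕ) (i : ZMod n) (r : ℕ), r + s < k → φ (α ^ r * y (i + s)) = φ (α ^ (r + s) * y i) := by
    intro s
    induction s with
    | zero => simp
    | succ s ih =>
      intro i r hrs
      obtain ⟨b, hb⟩ := hystep (i + s)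
      rw [show i + ((s + 1 : ℕ) : ZMod n) = i + s + 1 by push_cast; ring, hb, mul_add, map_add,
        mul_smul_comm, map_smul, hes r (by omega), smul_zero, add_zero, ← mul_assoc, ← pow_succ,
        ih i (r + 1) (by omega)]
      congr 3; ring
  refine ⟨fun i => φ (y i), fun i j hij => ?_⟩
  have h1 : y i - y j = 0 := by
    refine hwin _ fun s hs => ?_
    have h2 := hyw s i 0 (by omega)
    have h3 := hyw s j 0 (by omega)
    simp only [pow_zero, one_mul, zero_add] at h2 h3
    rw [mul_sub, map_sub, ← h2, ← h3]
    exact sub_eq_zero.2 (hij s hs)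
  exact ZMod.val_injective n (hxinj (ZMod.val_lt i) (ZMod.val_lt j) (sub_eq_zero.1 h1))

/-! ### Measures read from a cyclic sequence -/

theorem MeasureTheory.Measure.map_equiv_count {α : Type*} [MeasurableSpace α]
    [DiscreteMeasurableSpace α] [Countable α] (f : α ≃ α) :
    (Measure.count : Measure α).map f = Measure.count := by
  refine Measure.ext_of_singleton fun a => ?_
  rw [Measure.map_apply (.of_discrete) (measurableSet_singleton a)]
  have : f ⁻¹' {a} = {f.symm a} := by ext; simp [Equiv.eq_symm_apply]
  rw [this, Measure.count_singleton, Measure.count_singleton]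

/-- The measure of total mass `n` on configurations on `Λ` obtained by reading a cyclic sequence of
length `n`, at the places given by `r`, from each of its `n` starting points. -/
noncomputable def cyclicMeasure {n : ℕ} {Λ : Type*} (c : ZMod n → Fin 2) (r : Λ → ZMod n) :
    Measure (Config Λ) :=
  (Measure.count : Measure (ZMod n)).map fun i s => c (i + r s)

theorem map_cyclicMeasure {n : ℕ} {Λ Λ' : Type*} (c : ZMod n → Fin 2) (r : Λ → ZMod n)
    (f : Λ' → Λ) :
    (cyclicMeasure c r).map (fun η s => η (f s)) = cyclicMeasure c fun s => r (f s) := by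
  rw [cyclicMeasure, Measure.map_map
    (measurable_pi_lambda _ fun _ => measurable_pi_apply _) .of_discrete]
  rfl

/-- A shift of the reading places is absorbed by the uniform starting point. -/
theorem cyclicMeasure_add {n : ℕ} [NeZero n] {Λ : Type*} (c : ZMod n → Fin 2) (r : Λ → ZMod n)
    (t : ZMod n) : cyclicMeasure c (fun s => r s + t) = cyclicMeasure c r := by
  conv_rhs => rw [cyclicMeasure, ← Measure.map_equiv_count (Equiv.addRight t)]
  rw [Measure.map_map .of_discrete .of_discrete, cyclicMeasure]
  congr 1
  funext i s
  simp only [Function.comp, Equiv.coe_addRight]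
  congr 1
  ring

theorem cyclicMeasure_univ {n : ℕ} [NeZero n] {Λ : Type*} (c : ZMod n → Fin 2)
    (r : Λ → ZMod n) : cyclicMeasure c r Set.univ = n := by
  rw [cyclicMeasure, Measure.map_apply .of_discrete .univ, Set.preimage_univ]
  simp [Measure.count_apply]

theorem isLTI_cyclicMeasure {n : ℕ} [NeZero n] {Λ : Set ℤ} (c : ZMod n → Fin 2) :
    IsLTI (cyclicMeasure c fun s : Λ => ((s : ℤ) : ZMod n)) := by
  intro A t hA hA'
  have h1 : marginal hA' (cyclicMeasure c fun s : Λ => ((s : ℤ) : ZMod n)) =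
      cyclicMeasure c fun s : ↥((fun i : ℤ => i + t) '' A) => ((s : ℤ) : ZMod n) :=
    map_cyclicMeasure c (fun s : Λ => ((s : ℤ) : ZMod n))
      fun s : ↥((fun i : ℤ => i + t) '' A) => (⟨s, hA' s.2⟩ : Λ)
  have h2 : marginal hA (cyclicMeasure c fun s : Λ => ((s : ℤ) : ZMod n)) =
      cyclicMeasure c fun s : A => ((s : ℤ) : ZMod n) :=
    map_cyclicMeasure c (fun s : Λ => ((s : ℤ) : ZMod n)) fun s : A => (⟨s, hA s.2⟩ : Λ)
  rw [h1, h2, ← cyclicMeasure_add c _ (-(t : ZMod n))]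
  have hsub : ∀ s : ↥((fun i : ℤ => i + t) '' A), (s : ℤ) - t ∈ A := by
    rintro ⟨_, j, hj, rfl⟩
    simpa using hj
  refine Eq.trans ?_ (map_cyclicMeasure c (fun s : A => ((s : ℤ) : ZMod n))
    fun s : ↥((fun i : ℤ => i + t) '' A) => (⟨(s : ℤ) - t, hsub s⟩ : A)).symm
  congr 1
  funext s
  push_cast
  ring

theorem IsLTI.smul {Λ : Set ℤ} {μ : Measure (Config Λ)} (h : IsLTI μ) (a : ENNReal) :
    IsLTI (a • μ) := by
  intro A t hA hA'
  have := h A t hA hA'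
  simp only [marginal, Measure.map_smul] at this ⊢
  rw [this]

/-! ### Necessity of divisibility -/

/-- If the windows of length `k` of a cyclic sequence of length `n` are pairwise distinct, then
the uniform measure on its windows of length `k + 1` extends only to rings of length divisible by
`n`. -/
theorem dvd_of_extendsOnRing {k L n : ℕ} [NeZero n] [NeZero L] (c : ZMod n → Fin 2)
    (hc : ∀ i j : ZMod n, (∀ s < k, c (i + s) = c (j + s)) → i = j)
    (ν : Measure (Config (ZMod L))) [IsProbabilityMeasure ν] (hν : IsTIRing ν) (a : ENNReal)
    (hext : ExtendsOnRing ν (a • cyclicMeasure c fun s : interval k => ((s : ℤ) : ZMod n))) :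
    n ∣ L := by
  let S : Set (Config (interval k)) := Set.range fun (j : ZMod n) s => c (j + ((s : ℤ) : ZMod n))
  have hS : MeasurableSet S := (Set.finite_range _).measurableSet
  have h0 : ∀ᵐ η ∂ν, (fun s : interval k => η ((s : ℤ) : ZMod L)) ∈ S := by
    have h1 : ∀ᵐ ξ ∂(a • cyclicMeasure c fun s : interval k => ((s : ℤ) : ZMod n)), ξ ∈ S := by
      refine Measure.ae_smul_measure ?_ a
      refine (ae_map_iff Measurable.of_discrete.aemeasurable hS).2 ?_
      exact Filter.Eventually.of_forall fun j => ⟨j, rfl⟩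
    rw [← hext] at h1
    exact ae_of_ae_map (Measurable.of_discrete).aemeasurable h1
  have hall : ∀ᵐ η ∂ν, ∀ i : ZMod L, (fun s : interval k => η (((s : ℤ) : ZMod L) + i)) ∈ S := by
    refine ae_all_iff.2 fun i => ?_
    have h1 := h0
    rw [← hν i] at h1
    exact ae_of_ae_map (f := fun (η : Config (ZMod L)) (j : ZMod L) => η (j + i))
      (Measurable.of_discrete).aemeasurable h1
  obtain ⟨η, hη⟩ := hall.exists
  choose j hj using hη
  have hval : ∀ (i : ZMod L) (s : ℕ), s ≤ k → c (j i + s) = η (s + i) := by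
    intro i s hs
    have := congrFun (hj i) ⟨(s : ℤ), by simp [interval, hs]⟩
    simpa using this
  -- Consecutive windows overlap in k sites, and k letters determine the position in the cycle.
  have hstep : ∀ i, j (i + 1) = j i + 1 := by
    intro i
    refine hc _ _ fun s hs => ?_
    have h1 := hval (i + 1) s hs.le
    have h2 := hval i (s + 1) hs
    rw [h1, show j i + 1 + (s : ZMod n) = j i + ((s + 1 : ℕ) : ZMod n) by push_cast; ring, h2]
    congr 1
    push_cast
    ring
  have hiter : ∀ m : ℕ, j m = j 0 + m := by
    intro m
    induction m with
    | zero => simp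
    | succ m ih => push_cast; rw [hstep, ih]; ring
  have := hiter L
  rw [ZMod.natCast_self, left_eq_add] at this
  exact (ZMod.natCast_eq_zero_iff _ _).1 this

/-! ### Sufficiency of divisibility -/

/-- The windows of length `k` obtained from a configuration on `{0, …, k}` by forgetting its last
site (`d = 0`) or its first site (`d = 1`). -/
def subwindow {k : ℕ} (d : Fin 2) (η : Config (interval k)) : Fin k → Fin 2 :=
  fun s => η ⟨(s : ℤ) + (d : ℕ), by constructor <;> omega⟩

/-- Flow balance at the vertex w: LTI for A = {0, …, k - 1} and t = 1. -/
theorem IsLTI.measure_subwindow {k : ℕ} {μ : Measure (Config (interval k))} (h : IsLTI μ)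
    (w : Fin k → Fin 2) : μ (subwindow 0 ⁻¹' {w}) = μ (subwindow 1 ⁻¹' {w}) := by
  let A : Set ℤ := Set.Ico 0 (k : ℤ)
  have hA : A ⊆ interval k := fun i hi => ⟨hi.1, hi.2.le⟩
  have hA' : (fun i : ℤ => i + 1) '' A ⊆ interval k := by
    rintro _ ⟨i, hi, rfl⟩
    exact ⟨by have := hi.1; dsimp; omega, by have := hi.2; dsimp; omega⟩
  let T : Set (Config ((fun i : ℤ => i + 1) '' A)) :=
    {ξ | (fun s : Fin k => ξ ⟨(s : ℤ) + 1, s, ⟨by simp, by simp⟩, rfl⟩) = w}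
  have hT : MeasurableSet T := by
    refine measurableSet_eq_fun (measurable_pi_lambda _ fun _ => measurable_pi_apply _)
      measurable_const
  have h1 := congrArg (fun m => m T) (h A 1 hA hA')
  simp only [marginal] at h1
  have hr : ∀ {B : Set ℤ} (hB : B ⊆ interval k),
      Measurable (Set.domRestrict₂ (π := fun _ : ℤ => Fin 2) hB) := fun hB =>
    measurable_pi_lambda _ fun _ => measurable_pi_apply _
  rw [Measure.map_map (measurable_translateConfig A 1) (hr hA), Measure.map_apply (hr hA') hT,
    Measure.map_apply ((measurable_translateConfig A 1).comp (hr hA)) hT] at h1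
  have h2 : subwindow 1 ⁻¹' {w} = Set.domRestrict₂ (π := fun _ : ℤ => Fin 2) hA' ⁻¹' T := by
    rfl
  have h3 : subwindow 0 ⁻¹' {w} =
      (translateConfig A 1 ∘ Set.domRestrict₂ (π := fun _ : ℤ => Fin 2) hA) ⁻¹' T := by
    ext η
    have : subwindow 0 η = fun s : Fin k => η ⟨(s : ℤ) + 1 - 1, by constructor <;> omega⟩ := by
      funext s
      simp [subwindow]
    rw [Set.mem_preimage, Set.mem_singleton_iff, this]
    rfl
  rw [h2, h3, h1]

/-- Every locally translation invariant finite measure extends to every ring whose length is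
divisible by `1, 2, …, 2 ^ k`. -/
theorem IsLTI.exists_extendsOnRing {k L : ℕ} [NeZero L] (hL : ∀ n, 0 < n → n ≤ 2 ^ k → n ∣ L)
    (μ : Measure (Config (interval k))) [IsFiniteMeasure μ] (hμ : IsLTI μ) :
    ∃ ν : Measure (Config (ZMod L)), IsTIRing ν ∧ ExtendsOnRing ν μ := by
  classical
  let R : Config (ZMod L) → Config (interval k) := fun η i => η ((i : ℤ) : ZMod L)
  have key : ∃ ν : Measure (Config (ZMod L)), IsTIRing ν ∧
      ∀ ξ, ν.map R {ξ} = ((μ {ξ}).toNNReal : ENNReal) := by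
    refine circulation_induction (V := Fin k → Fin 2) (E := Config (interval k)) (subwindow 0)
      (subwindow 1) (fun m => ∃ ν : Measure (Config (ZMod L)), IsTIRing ν ∧
        ∀ ξ, ν.map R {ξ} = (m ξ : ENNReal)) ?_ ?_ ?_ ?_ (fun ξ => (μ {ξ}).toNNReal) ?_
    · exact ⟨0, fun t => Measure.map_zero _, by simp⟩
    · rintro m m' ⟨ν, hν, h⟩ ⟨ν', hν', h'⟩
      refine ⟨ν + ν', fun t => ?_, fun ξ => ?_⟩
      · rw [Measure.map_add _ _ .of_discrete, hν, hν']
      · rw [Measure.map_add _ _ .of_discrete, Measure.add_apply, h, h']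
        simp
    · rintro a m ⟨ν, hν, h⟩
      refine ⟨(a : ENNReal) • ν, fun t => ?_, fun ξ => ?_⟩
      · rw [Measure.map_smul, hν]
      · rw [Measure.map_smul, Measure.smul_apply, h]
        simp
    · intro n _ e hn hstep he
      have hnL : n ∣ L := hL n (Nat.pos_of_ne_zero (NeZero.ne n)) (by simpa using hn)
      let c : ZMod n → Fin 2 := fun i => e i ⟨0, by simp [interval]⟩
      -- The first letters of its edges spell out the whole cycle.
      have hce : ∀ (s : ℕ) (hs : s ≤ k) (i : ZMod n),
          e i ⟨s, by simp [interval, hs]⟩ = c (i + s) := by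
        intro s
        induction s with
        | zero => intro _ i; simp [c]
        | succ s ih =>
          intro hs i
          have := congrFun (hstep i) ⟨s, by omega⟩
          simp only [subwindow] at this
          have h2 := ih (by omega) (i + 1)
          rw [show i + ((s + 1 : ℕ) : ZMod n) = i + 1 + s by push_cast; ring, ← h2]
          simpa using this
      refine ⟨cyclicMeasure c (ZMod.castHom hnL (ZMod n)), fun t => ?_, fun ξ => ?_⟩
      · rw [map_cyclicMeasure c _ fun i => i + t]
        simp only [map_add]
        exact cyclicMeasure_add c _ _
      · have hR : (cyclicMeasure c (ZMod.castHom hnL (ZMod n))).map R = Measure.count.map e := by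
          rw [map_cyclicMeasure c _ fun i : interval k => ((i : ℤ) : ZMod L), cyclicMeasure]
          congr 1
          funext i s
          obtain ⟨s, hs0, hsk⟩ := s
          lift s to ℕ using hs0
          rw [hce s (by exact_mod_cast hsk)]
          simp
        rw [hR, Measure.map_apply .of_discrete (measurableSet_singleton ξ)]
        by_cases hξ : ξ ∈ Set.range e
        · obtain ⟨i, rfl⟩ := hξ
          have : e ⁻¹' {e i} = {i} := by ext; simp [he.eq_iff]
          rw [this]
          simp
        · simp only [if_neg hξ]
          rw [Set.preimage_singleton_eq_empty.2 hξ]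
          simp
    · intro w
      have hsum : ∀ f : Config (interval k) → (Fin k → Fin 2),
          ∑ ξ with f ξ = w, (μ {ξ}).toNNReal = (μ (f ⁻¹' {w})).toNNReal := by
        intro f
        rw [← ENNReal.toNNReal_sum fun _ _ => measure_ne_top _ _, sum_measure_singleton]
        congr 2
        ext
        simp
      rw [hsum, hsum, hμ.measure_subwindow]
  obtain ⟨ν, hν, h⟩ := key
  refine ⟨ν, hν, Measure.ext_of_singleton fun ξ => ?_⟩
  exact (h ξ).trans (ENNReal.coe_toNNReal (measure_ne_top _ _))

theorem mainTheorem5 (k : ℕ) :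
    IsLeast
      {L : ℕ | k + 1 ≤ L ∧
        ∀ μ : Measure (Config (interval k)), IsProbabilityMeasure μ → IsLTI μ →
          ∃ ν : Measure (Config (ZMod L)),
            IsProbabilityMeasure ν ∧ IsTIRing ν ∧ ExtendsOnRing ν μ}
      ((Finset.Icc 1 (2 ^ k)).lcm id) := by
  have hdvd : ∀ n, 0 < n → n ≤ 2 ^ k → n ∣ (Finset.Icc 1 (2 ^ k)).lcm id := fun n h0 hn =>
    Finset.dvd_lcm (f := id) (Finset.mem_Icc.2 ⟨h0, hn⟩)
  have hne : (Finset.Icc 1 (2 ^ k)).lcm id ≠ 0 := by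
    simp [Finset.lcm_eq_zero_iff]
  refine ⟨⟨?_, fun μ _ hμ => ?_⟩, fun L hL => ?_⟩
  · exact (Nat.lt_two_pow_self (n := k)).trans_le
      (Nat.le_of_dvd (Nat.pos_of_ne_zero hne) (hdvd _ (by positivity) le_rfl))
  · have : NeZero ((Finset.Icc 1 (2 ^ k)).lcm id) := ⟨hne⟩
    obtain ⟨ν, hν, hext⟩ := hμ.exists_extendsOnRing hdvd
    refine ⟨ν, ?_, hν, hext⟩
    have : IsProbabilityMeasure (ν.map
        fun (η : Config (ZMod ((Finset.Icc 1 (2 ^ k)).lcm id))) (i : interval k) =>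
          η ((i : ℤ) : ZMod ((Finset.Icc 1 (2 ^ k)).lcm id))) :=
      hext.symm ▸ ‹IsProbabilityMeasure μ›
    exact Measure.isProbabilityMeasure_of_map
      fun (η : Config (ZMod ((Finset.Icc 1 (2 ^ k)).lcm id))) (i : interval k) =>
        η ((i : ℤ) : ZMod ((Finset.Icc 1 (2 ^ k)).lcm id))
  · obtain ⟨hkL, hL⟩ := hL
    have : NeZero L := ⟨by omega⟩
    refine Nat.le_of_dvd (by omega) (Finset.lcm_dvd fun n hn => ?_)
    obtain ⟨h1, h2⟩ := Finset.mem_Icc.1 hn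
    change n ∣ L
    have : NeZero n := ⟨by omega⟩
    obtain ⟨c, hc⟩ := exists_cyclic_sequence k n h2
    obtain ⟨ν, hν, hTI, hext⟩ := hL
      ((n : ENNReal)⁻¹ • cyclicMeasure c fun s : interval k => ((s : ℤ) : ZMod n))
      ⟨by
        rw [Measure.smul_apply, cyclicMeasure_univ, smul_eq_mul]
        exact ENNReal.inv_mul_cancel (by simpa using NeZero.ne n) (ENNReal.natCast_ne_top n)⟩
      ((isLTI_cyclicMeasure c).smul _)
    exact dvd_of_extendsOnRing c hc ν hTI _ hext
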